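/- **Area-Product Bound.** Fix $d\ge 2$. A convex body $K\subset\mathbb R^d$ is a compact convex set with nonempty interior; it is $\gamma$-fat ($0<\gamma\le 1$) if there are concentric balls $B\subseteq K\subseteq B'$ with $\mathrm{radius}(B)/\mathrm{radius}(B')\ge\gamma$. Write $\mathrm{area}$ for the $(d-1)$-dimensional Hausdorff measure and $S$ for the sphere of radius $3$ centered at the origin. An augmented boundary point of $K$ is a pair $(q,h')$ of a point $q\in\partial K$ and a supporting hyperplane $h'$ of $K$ through $q$. Given an augmented boundary point $(p,h)$ and $\varepsilon>0$, let $p_\varepsilon=p+\varepsilon u$, where $u$ is the outward unit normal of $h$. The $\varepsilon$-dual cap of $(p,h)$ is the set of augmented boundary points $(q,h')$ such that $h'$ meets the closed segment $\overline{pp_\varepsilon}$, and the $\delta$-restricted $\varepsilon$-dual cap consists of those $(q,h')$ in it with $\|q-p\|\le\delta$. For a set $X$ of augmented boundary points, $\mathrm{area}(X)$ is the area of the set of points $q$ with $(q,h')\in X$ for some $h'$, and $\mathrm{Vor}(X)$ is the set of points $z\notin K$ such that $(q,h')\in X$, where $q$ is the point of $\partial K$ closest to $z$ and $h'$ is the supporting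 hyperplane through $q$ orthogonal to $\overline{zq}$. There are constants $c'_a>0$ and $c_a>0$ depending only on $d$ such that for every convex body $K\subset\mathbb R^d$, every $0<\varepsilon\le 1/8$ and every augmented boundary point $(p,h)$ of $K$, the $\sqrt\varepsilon$-restricted $\varepsilon$-dual cap $D$ of $(p,h)$ satisfies the following. (i) For every $y\ge 1$, if $H^{(y)}$ denotes the hyperplane parallel to $h$ and translated away from $K$ by distance $y$, then $$\mathrm{area}(D)\cdot\mathrm{area}\big(\mathrm{Vor}(D)\cap H^{(y)}\big)\ \ge\ c'_a\,\varepsilon^{d-1}.$$ (ii) If $K$ is $\gamma$-fat for some $0<\gamma\le 1$ and has diameter at least $2\varepsilon$, and $\|p\|\le 1$, then $$\mathrm{area}(D)\cdot\mathrm{area}\big(\mathrm{Vor}(D)\cap S\big)\ >\ c_a\,\gamma^{d-1}\,\varepsilon^{d-1}.$$ In particular, for bodies that are fat with a fixed constant $\gamma$, the bound is a constant times $\varepsilon^{d-1}$. -/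

import Mathlib

open MeasureTheory
open scoped RealInnerProductSpace

/-- `IsFat γ K`: there are concentric balls `B ⊆ K ⊆ B'` of positive radii `r` and `R` with
`r / R ≥ γ`. -/
def IsFat {d : ℕ} (γ : ℝ) (K : Set (EuclideanSpace ℝ (Fin d))) : Prop :=
  ∃ (c : EuclideanSpace ℝ (Fin d)) (r R : ℝ), 0 < r ∧ 0 < R ∧ γ ≤ r / R ∧
    Metric.closedBall c r ⊆ K ∧ K ⊆ Metric.closedBall c R

/-- The augmented boundary of `K`: pairs `(q, v)` of a boundary point `q` and the outward unit
normal `v` of a supporting hyperplane `{x | ⟪x - q, v⟫ = 0}` of `K` through `q`.  A boundary point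
occurs once for each of its supporting hyperplanes. -/
def augmentedBoundary {d : ℕ} (K : Set (EuclideanSpace ℝ (Fin d))) :
    Set (EuclideanSpace ℝ (Fin d) × EuclideanSpace ℝ (Fin d)) :=
  {b | b.1 ∈ frontier K ∧ ‖b.2‖ = 1 ∧ ∀ x ∈ K, ⟪x - b.1, b.2⟫ ≤ 0}

/-- The `ε`-dual cap of the augmented boundary point `a = (p, u)`: the augmented boundary points
whose supporting hyperplane meets the closed segment from `p` to `p + ε u`. -/
def dualCap {d : ℕ} (K : Set (EuclideanSpace ℝ (Fin d))) (ε : ℝ)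
    (a : EuclideanSpace ℝ (Fin d) × EuclideanSpace ℝ (Fin d)) :
    Set (EuclideanSpace ℝ (Fin d) × EuclideanSpace ℝ (Fin d)) :=
  {b | b ∈ augmentedBoundary K ∧ ∃ x ∈ segment ℝ a.1 (a.1 + ε • a.2), ⟪x - b.1, b.2⟫ = 0}

/-- The `δ`-restricted `ε`-dual cap of `a = (p, u)`: the part of the `ε`-dual cap in the closed ball
of radius `δ` centered at `p`. -/
def restrictedDualCap {d : ℕ} (K : Set (EuclideanSpace ℝ (Fin d))) (ε δ : ℝ)
    (a : EuclideanSpace ℝ (Fin d) × EuclideanSpace ℝ (Fin d)) :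
    Set (EuclideanSpace ℝ (Fin d) × EuclideanSpace ℝ (Fin d)) :=
  {b | b ∈ dualCap K ε a ∧ b.1 ∈ Metric.closedBall a.1 δ}

/-- `Vor(X)` for a set `X` of augmented boundary points: the points `z` exterior to `K` whose closest
augmented point lies in `X`, that is, `(q, v) ∈ X` where `q` is the point of `∂K` closest to `z` and
the supporting hyperplane at `q` is the one orthogonal to the segment from `q` to `z`.
(This is contained in the set of exterior points whose closest point is the first component of some
element of `X`, so lower bounds for its measure are at least as strong.) -/
def vor {d : ℕ} (K : Set (EuclideanSpace ℝ (Fin d)))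
    (X : Set (EuclideanSpace ℝ (Fin d) × EuclideanSpace ℝ (Fin d))) :
    Set (EuclideanSpace ℝ (Fin d)) :=
  {z | z ∉ K ∧ ∃ q ∈ frontier K, dist z q = Metric.infDist z (frontier K) ∧
    (q, ‖z - q‖⁻¹ • (z - q)) ∈ X}

/-- The points underlying a set of augmented points. -/
def patch {d : ℕ} (X : Set (EuclideanSpace ℝ (Fin d) × EuclideanSpace ℝ (Fin d))) :
    Set (EuclideanSpace ℝ (Fin d)) :=
  Prod.fst '' X

/-- The area of a subset of `ℝ^d`: its `(d-1)`-dimensional Hausdorff measure. -/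
noncomputable def area {d : ℕ} (Y : Set (EuclideanSpace ℝ (Fin d))) : ENNReal :=
  μH[(d : ℝ) - 1] Y

/-- The hyperplane parallel to the supporting hyperplane of `a = (p, u)`, translated away from the
body by distance `y`. -/
def parallelHyperplane {d : ℕ} (a : EuclideanSpace ℝ (Fin d) × EuclideanSpace ℝ (Fin d)) (y : ℝ) :
    Set (EuclideanSpace ℝ (Fin d)) :=
  {x | ⟪x - a.1, a.2⟫ = y}

/-! ### Maximal simplices and their polars -/

/-! The bound is a Mahler-type volume product in dimension n = d - 1. Put the origin at p and let P
be the projection along u. To each x in K attach the scale m(x) = ε + ‖x‖² - 2⟪x, u⟫ (`capScale`)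
and the vector φ(x) = (2 / m(x)) P x; let G = φ(K).

The scale serves both factors. The point (ε / m(x)) x lies in K, within √ε of p and at depth at most
ε, and D has a point above half of every such point (`exists_mem_patch_above_midpoint`). Hence P(D)
contains (ε / 4) conv({0} ∪ G). Dually, if ⟪w, φ(x)⟫ ≤ 1 for all x in K, every point at height y ≥ 1
above w is in Vor(D) (`mem_vor_restrictedDualCap`), so the Voronoi slice lies over the polar of G.

To bound the product, choose n vectors of G with maximal |det|. The convex hull contains their
corner simplex, and the polar contains their `polarParallelotope`. A linear change of basis
multiplies these two volumes by reciprocal factors, so their product is a constant of n. Projection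
is 1-Lipschitz, which turns volumes below into areas above. For the sphere, fatness bounds the polar
by 3 / γ; shrunk by γ / 3, it lies under points of S at height at least 1. -/

/-- A compact spanning set contains a basis in which all coordinates of all its points are at most
one in absolute value. -/
lemma exists_linearIndependent_coord_le_one {n : ℕ} {G : Set (EuclideanSpace ℝ (Fin n))}
    (hG : IsCompact G) (hspan : Submodule.span ℝ G = ⊤) :
    ∃ g : Fin n → EuclideanSpace ℝ (Fin n), (∀ i, g i ∈ G) ∧ LinearIndependent ℝ g ∧
      ∀ x ∈ G, ∃ t : Fin n → ℝ, (∀ i, |t i| ≤ 1) ∧ x = ∑ i, t i • g i := by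
  set e := (EuclideanSpace.basisFun (Fin n) ℝ).toBasis with he
  obtain ⟨b, hbG, hbs, hbi⟩ := exists_linearIndependent ℝ G
  obtain ⟨v, hvG, hv⟩ : ∃ v : Fin n → EuclideanSpace ℝ (Fin n),
      (∀ i, v i ∈ G) ∧ e.det v ≠ 0 := by
    let B : Module.Basis b ℝ (EuclideanSpace ℝ (Fin n)) :=
      Module.Basis.mk hbi (by simp [hbs, hspan])
    refine ⟨B.reindex (B.indexEquiv e), fun i => ?_, (e.isUnit_det _).ne_zero⟩
    simpa [B] using hbG (Subtype.coe_prop _)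
  have hcont : Continuous fun w : Fin n → EuclideanSpace ℝ (Fin n) => |e.det w| := by
    have : Continuous fun w : Fin n → EuclideanSpace ℝ (Fin n) => e.det w :=
      Continuous.matrix_det <| continuous_matrix fun i j => by
        simp only [he, Module.Basis.toMatrix_apply, OrthonormalBasis.coe_toBasis_repr_apply,
          EuclideanSpace.basisFun_repr]
        fun_prop
    exact this.abs
  have hcomp : IsCompact (Set.univ.pi fun _ : Fin n => G) := isCompact_univ_pi fun _ => hG
  obtain ⟨g, hgG, hmax⟩ := hcomp.exists_isMaxOn ⟨v, fun i _ => hvG i⟩ hcont.continuousOn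
  have hdet : 0 < |e.det g| :=
    (abs_pos.2 hv).trans_le (hmax (Set.mem_univ_pi.2 hvG))
  obtain ⟨hli, hsp⟩ := e.is_basis_iff_det.2 (isUnit_iff_ne_zero.2 (abs_pos.1 hdet))
  refine ⟨g, fun i => hgG i trivial, hli, fun x hx => ?_⟩
  refine ⟨fun i => (Module.Basis.mk hli hsp.ge).coord i x, fun i => ?_, ?_⟩
  -- Cramer's rule: the coordinate is the ratio of two determinants, and replacing `g i` by `x`
  -- cannot increase |det|.
  · have h := congrArg (fun f => f x) (e.det_smul_mk_coord_eq_det_update hli hsp.ge i)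
    simp only [LinearMap.smul_apply, smul_eq_mul, MultilinearMap.toLinearMap_apply] at h
    have hu : |e.det (Function.update g i x)| ≤ |e.det g| := by
      refine hmax (Set.mem_univ_pi.2 fun k => ?_)
      rcases eq_or_ne k i with rfl | hk
      · simpa using hx
      · simpa [hk] using hgG k trivial
    have h' : |e.det g| * |(Module.Basis.mk hli hsp.ge).coord i x| ≤ |e.det g| := by
      rw [← abs_mul, h]; exact hu
    exact le_of_mul_le_mul_left (by simpa using h') hdet
  · simpa using ((Module.Basis.mk hli hsp.ge).sum_repr x).symm

/-- The simplex with vertices `0` and `g i`. -/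
def cornerSimplex {n : ℕ} (g : Fin n → EuclideanSpace ℝ (Fin n)) :
    Set (EuclideanSpace ℝ (Fin n)) :=
  {x | ∃ t : Fin n → ℝ, (∀ i, 0 ≤ t i) ∧ ∑ i, t i ≤ 1 ∧ x = ∑ i, t i • g i}

/-- The polar of the parallelotope of the sums of `t i • g i` with `|t i| ≤ n`. -/
def polarParallelotope {n : ℕ} (g : Fin n → EuclideanSpace ℝ (Fin n)) :
    Set (EuclideanSpace ℝ (Fin n)) :=
  {z | ∀ i, n * |⟪g i, z⟫| ≤ 1}

/-- The product of the measures of the corner simplex and of the polar parallelotope does not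
depend on the basis. -/
lemma exists_pos_lt_measure_cornerSimplex_mul_polarParallelotope (n : ℕ)
    (μ : Measure (EuclideanSpace ℝ (Fin n))) [μ.IsAddHaarMeasure] :
    ∃ C : ℝ, 0 < C ∧ ∀ g : Fin n → EuclideanSpace ℝ (Fin n), LinearIndependent ℝ g →
      ENNReal.ofReal C < μ (cornerSimplex g) * μ (polarParallelotope g) := by
  set b := EuclideanSpace.basisFun (Fin n) ℝ with hb
  have hT : 0 < μ (cornerSimplex b) := by
    let U : Set (EuclideanSpace ℝ (Fin n)) := {x | (∀ i, 0 < x i) ∧ ∑ i, x i < 1}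
    have hU : IsOpen U := by
      have : U = (⋂ i, {x | 0 < x i}) ∩ {x | ∑ i, x i < 1} := by ext; simp [U]
      rw [this]
      refine (isOpen_iInter_of_finite fun i => ?_).inter ?_
      · exact isOpen_lt continuous_const (by fun_prop)
      · exact isOpen_lt (by fun_prop) continuous_const
    have hne : U.Nonempty := by
      refine ⟨WithLp.toLp 2 fun _ => 1 / (n + 1 : ℝ), fun i => by simp; positivity, ?_⟩
      simp only [Finset.sum_const, Finset.card_univ, Fintype.card_fin, nsmul_eq_mul]
      rw [mul_one_div, div_lt_one (by positivity)]
      linarith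
    refine (hU.measure_pos μ hne).trans_le (measure_mono fun x hx => ?_)
    refine ⟨fun i => x i, fun i => (hx.1 i).le, hx.2.le, ?_⟩
    simpa [hb] using (b.sum_repr x).symm
  have hQ : 0 < μ (polarParallelotope b) := by
    have hU : IsOpen {z : EuclideanSpace ℝ (Fin n) | ∀ i, n * |⟪b i, z⟫| < 1} := by
      simp only [Set.ofPred_forall]
      exact isOpen_iInter_of_finite fun i => isOpen_lt (by fun_prop) continuous_const
    exact (hU.measure_pos μ ⟨0, by simp⟩).trans_le (measure_mono fun x hx i => (hx i).le)
  obtain ⟨r, hr0, hr⟩ := ENNReal.lt_iff_exists_nnreal_btwn.1 (ENNReal.mul_pos hT.ne' hQ.ne')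
  refine ⟨r, by simpa using hr0, fun g hg => ?_⟩
  rw [ENNReal.ofReal_coe_nnreal]
  refine hr.trans_le (le_of_eq ?_)
  -- The simplex is an image under `L` and the polar set a preimage under its adjoint, so the
  -- factors |det L| and |det L|⁻¹ cancel.
  let L : EuclideanSpace ℝ (Fin n) →ₗ[ℝ] EuclideanSpace ℝ (Fin n) := b.toBasis.constr ℝ g
  have hL : ∀ i, L (b i) = g i := fun i => by
    rw [← b.coe_toBasis]; exact b.toBasis.constr_basis ℝ g i
  have hdet : LinearMap.det L ≠ 0 := by
    have hu : IsUnit (b.toBasis.det g) :=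
      b.toBasis.is_basis_iff_det.1 ⟨hg, hg.span_eq_top_of_card_eq_finrank' (by simp)⟩
    have : g = L ∘ b.toBasis := by ext1 i; simp [hL]
    rw [this, b.toBasis.det_comp_basis] at hu
    simpa using hu.ne_zero
  have hadj : LinearMap.det (LinearMap.adjoint L) = LinearMap.det L := by
    rw [← LinearMap.det_toMatrix b.toBasis, ← LinearMap.det_toMatrix b.toBasis,
      LinearMap.toMatrix_adjoint, Matrix.det_conjTranspose]
    simp
  have h1 : cornerSimplex g = L '' cornerSimplex b := by
    ext x
    constructor
    · rintro ⟨t, h0, h1, rfl⟩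
      exact ⟨∑ i, t i • b i, ⟨t, h0, h1, rfl⟩, by simp [hL]⟩
    · rintro ⟨_, ⟨t, h0, h1, rfl⟩, rfl⟩
      exact ⟨t, h0, h1, by simp [hL]⟩
  have h2 : polarParallelotope g = LinearMap.adjoint L ⁻¹' polarParallelotope b := by
    ext z
    simp [polarParallelotope, LinearMap.adjoint_inner_right, ← hL]
  rw [h1, h2, Measure.addHaar_image_linearMap, Measure.addHaar_preimage_linearMap _ (hadj ▸ hdet),
    hadj, mul_mul_mul_comm, ← ENNReal.ofReal_mul (abs_nonneg _), ← abs_mul,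
    mul_inv_cancel₀ hdet]
  simp

/-! ### Membership in Voronoi regions and in patches of restricted dual caps -/

section Membership

variable {d : ℕ} {K : ConvexBody (EuclideanSpace ℝ (Fin d))} {ε : ℝ}
  {a : EuclideanSpace ℝ (Fin d) × EuclideanSpace ℝ (Fin d)}

/-- An augmented boundary point belongs to the dual cap of `(p, u)` as soon as `p + ε u` is not
strictly inside its supporting half-space. -/
lemma mem_dualCap_of_nonneg {b : EuclideanSpace ℝ (Fin d) × EuclideanSpace ℝ (Fin d)}
    (ha : a ∈ augmentedBoundary (K : Set (EuclideanSpace ℝ (Fin d))))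
    (hb : b ∈ augmentedBoundary (K : Set (EuclideanSpace ℝ (Fin d))))
    (h : 0 ≤ ⟪a.1 + ε • a.2 - b.1, b.2⟫) : b ∈ dualCap K ε a := by
  refine ⟨hb, ?_⟩
  have hp : a.1 ∈ (K : Set (EuclideanSpace ℝ (Fin d))) :=
    K.isCompact.isClosed.frontier_subset ha.1
  have h0 : ⟪a.1 - b.1, b.2⟫ ≤ 0 := hb.2.2 _ hp
  have hcont : ContinuousOn (fun x => ⟪x - b.1, b.2⟫) (segment ℝ a.1 (a.1 + ε • a.2)) := by
    fun_prop
  obtain ⟨x, hx, hx0⟩ := (convex_segment _ _).isPreconnected.intermediate_value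
    (left_mem_segment ℝ _ _) (right_mem_segment ℝ _ _) hcont ⟨h0, h⟩
  exact ⟨x, hx, hx0⟩

/-- A point at height at least one above the supporting hyperplane at `p`, whose squared distance
to `p` exceeds its squared distance to `K` by at most `ε`, is in the Voronoi region of the
restricted dual cap. -/
lemma mem_vor_restrictedDualCap {z : EuclideanSpace ℝ (Fin d)}
    (ha : a ∈ augmentedBoundary (K : Set (EuclideanSpace ℝ (Fin d)))) (hε : 0 ≤ ε)
    (hz : 1 ≤ ⟪z - a.1, a.2⟫)
    (h : ∀ x ∈ K, 2 * ⟪z - a.1, x - a.1⟫ - ‖x - a.1‖ ^ 2 ≤ ε) :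
    z ∈ vor K (restrictedDualCap K ε (Real.sqrt ε) a) := by
  have hcl : IsClosed (K : Set (EuclideanSpace ℝ (Fin d))) := K.isCompact.isClosed
  have hp : a.1 ∈ (K : Set (EuclideanSpace ℝ (Fin d))) := hcl.frontier_subset ha.1
  have hzK : z ∉ (K : Set (EuclideanSpace ℝ (Fin d))) := fun hzK => by
    linarith [ha.2.2 z hzK]
  obtain ⟨q, hqK, hq⟩ := hcl.exists_infDist_eq_dist K.nonempty z
  have hmin : ∀ x ∈ (K : Set (EuclideanSpace ℝ (Fin d))), dist z q ≤ dist z x := fun x hx =>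
    hq ▸ Metric.infDist_le_dist_of_mem hx
  have hobt : ∀ x ∈ (K : Set (EuclideanSpace ℝ (Fin d))), ⟪z - q, x - q⟫ ≤ 0 := by
    refine (norm_eq_iInf_iff_real_inner_le_zero K.convex hqK).1 ?_
    have : Nonempty (K : Set (EuclideanSpace ℝ (Fin d))) := ⟨⟨q, hqK⟩⟩
    refine le_antisymm (le_ciInf fun w => ?_) (ciInf_le ⟨0, ?_⟩ (⟨q, hqK⟩ : K))
    · simpa only [dist_eq_norm] using hmin w w.2
    · rintro _ ⟨w, rfl⟩
      exact norm_nonneg _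
  have hne : z - q ≠ 0 := sub_ne_zero.2 fun h => hzK (h ▸ hqK)
  have hnorm : 0 < ‖z - q‖ := norm_pos_iff.2 hne
  have hqf : q ∈ frontier (K : Set (EuclideanSpace ℝ (Fin d))) := by
    rw [hcl.frontier_eq]
    refine ⟨hqK, fun hint => ?_⟩
    obtain ⟨r, hr, hball⟩ := Metric.isOpen_iff.1 isOpen_interior q hint
    have hmem : q + (r / 2 / ‖z - q‖) • (z - q) ∈ (K : Set (EuclideanSpace ℝ (Fin d))) := by
      refine interior_subset (hball ?_)
      rw [Metric.mem_ball, dist_eq_norm, add_sub_cancel_left, norm_smul, Real.norm_eq_abs,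
        abs_of_pos (by positivity), div_mul_cancel₀ _ hnorm.ne']
      linarith
    have := hobt _ hmem
    rw [add_sub_cancel_left, inner_smul_right, real_inner_self_eq_norm_sq] at this
    have : 0 < r / 2 / ‖z - q‖ * ‖z - q‖ ^ 2 := by positivity
    linarith
  have hKint : (frontier (K : Set (EuclideanSpace ℝ (Fin d)))) ⊆ K := hcl.frontier_subset
  refine ⟨hzK, q, hqf, ?_, ?_⟩
  · exact le_antisymm ((Metric.le_infDist ⟨q, hqf⟩).2 fun x hx => hmin x (hKint hx))
      (Metric.infDist_le_dist_of_mem hqf)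
  have hexp := h q hqK
  -- At the nearest point, the hypothesis bounds a sum of two nonnegative terms by ε: ‖q - p‖² ≤ ε
  -- gives the restriction, and 2⟪z - q, q - p⟫ ≤ ε gives the dual cap.
  have h1 : 2 * ⟪z - a.1, q - a.1⟫ - ‖q - a.1‖ ^ 2 =
      ‖q - a.1‖ ^ 2 + 2 * ⟪z - q, q - a.1⟫ := by
    have : z - a.1 = (z - q) + (q - a.1) := by abel
    rw [this, inner_add_left, real_inner_self_eq_norm_sq]
    ring
  have h2 : 0 ≤ ⟪z - q, q - a.1⟫ := by
    have := hobt _ hp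
    rw [← neg_sub q a.1, inner_neg_right] at this
    linarith
  have hb : (q, ‖z - q‖⁻¹ • (z - q)) ∈
      augmentedBoundary (K : Set (EuclideanSpace ℝ (Fin d))) := by
    refine ⟨hqf, ?_, fun x hx => ?_⟩
    · simp [norm_smul, hnorm.ne']
    · simp only [inner_smul_right, real_inner_comm]
      exact mul_nonpos_of_nonneg_of_nonpos (by positivity) (hobt x hx)
  refine ⟨mem_dualCap_of_nonneg ha hb ?_, ?_⟩
  · simp only [inner_smul_right]
    refine mul_nonneg (by positivity) ?_
    -- ⟪u, z - q⟫ ≥ 1 because z has height at least 1 and q at most 0; so the inner product is at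
    -- least ε - ε / 2.
    have e1 : a.1 + ε • a.2 - q = ε • a.2 - (q - a.1) := by abel
    have e2 : ⟪a.2, z - q⟫ = ⟪z - a.1, a.2⟫ - ⟪q - a.1, a.2⟫ := by
      rw [← inner_sub_left, sub_sub_sub_cancel_right, real_inner_comm]
    have e3 := ha.2.2 q hqK
    rw [e1, inner_sub_left, inner_smul_left, real_inner_comm (z - q) (q - a.1)]
    simp only [conj_trivial]
    have : 1 ≤ ⟪a.2, z - q⟫ := by linarith
    nlinarith [sq_nonneg ‖q - a.1‖]
  · rw [Metric.mem_closedBall, dist_eq_norm]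
    exact Real.le_sqrt_of_sq_le (by linarith)

/-- Above the midpoint of `p` and a point `r` of `K` that is close to `p` and to the supporting
hyperplane at `p` there is a point of the patch of the restricted dual cap. -/
lemma exists_mem_patch_above_midpoint {r : EuclideanSpace ℝ (Fin d)}
    (hK : (interior (K : Set (EuclideanSpace ℝ (Fin d)))).Nonempty)
    (ha : a ∈ augmentedBoundary (K : Set (EuclideanSpace ℝ (Fin d)))) (hε : 0 < ε) (hε1 : ε ≤ 1)
    (hr : r ∈ K) (hdepth : -ε ≤ ⟪r - a.1, a.2⟫) (hnear : ‖r - a.1‖ ≤ Real.sqrt ε) :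
    ∃ q ∈ patch (restrictedDualCap K ε (Real.sqrt ε) a), ∃ t : ℝ,
      q - a.1 = (1 / 2 : ℝ) • (r - a.1) + t • a.2 := by
  have hcl : IsClosed (K : Set (EuclideanSpace ℝ (Fin d))) := K.isCompact.isClosed
  have hp : a.1 ∈ (K : Set (EuclideanSpace ℝ (Fin d))) := hcl.frontier_subset ha.1
  set m : EuclideanSpace ℝ (Fin d) := a.1 + (1 / 2 : ℝ) • (r - a.1) with hm
  have huu : ⟪a.2, a.2⟫ = 1 := by rw [real_inner_self_eq_norm_sq, ha.2.1]; norm_num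
  have hmK : m ∈ (K : Set (EuclideanSpace ℝ (Fin d))) := by
    have := K.convex hp hr (by norm_num : (0 : ℝ) ≤ 1 / 2) (by norm_num : (0 : ℝ) ≤ 1 / 2)
      (by norm_num)
    convert this using 1
    rw [hm]; module
  have hheight : ∀ t : ℝ, m + t • a.2 ∈ (K : Set (EuclideanSpace ℝ (Fin d))) → 2 * t ≤ ε := by
    intro t ht
    have := ha.2.2 _ ht
    have e : m + t • a.2 - a.1 = (1 / 2 : ℝ) • (r - a.1) + t • a.2 := by rw [hm]; abel
    rw [e, inner_add_left, inner_smul_left, inner_smul_left, huu] at this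
    simp only [conj_trivial] at this
    linarith
  -- The required point is the highest point of K above the midpoint m.
  set s : Set ℝ := {t | 0 ≤ t ∧ m + t • a.2 ∈ (K : Set (EuclideanSpace ℝ (Fin d)))} with hs
  have hscomp : IsCompact s := by
    refine isCompact_Icc.of_isClosed_subset (s := Set.Icc 0 (ε / 2)) ?_ fun t ht =>
      ⟨ht.1, by linarith [hheight t ht.2]⟩
    exact isClosed_Ici.inter (hcl.preimage (f := fun t : ℝ => m + t • a.2) (by fun_prop))
  obtain ⟨t, ⟨ht0, htK⟩, htmax⟩ := hscomp.exists_isGreatest ⟨0, le_rfl, by simpa using hmK⟩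
  set q := m + t • a.2 with hq
  have hqa : q - a.1 = (1 / 2 : ℝ) • (r - a.1) + t • a.2 := by rw [hq, hm]; abel
  have htε := hheight t htK
  -- a supporting hyperplane at `q` whose normal does not point downwards
  have hray : Convex ℝ ((fun l : ℝ => q + l • a.2) '' Set.Ioi 0) := by
    rintro _ ⟨x, hx, rfl⟩ _ ⟨y, hy, rfl⟩ α β hα hβ hαβ
    refine ⟨α * x + β * y, ?_, ?_⟩
    · exact (convex_Ioi (0 : ℝ)) hx hy hα hβ hαβ
    · have : β = 1 - α := by linarith
      subst this
      module
  have hdisj : Disjoint (interior (K : Set (EuclideanSpace ℝ (Fin d))))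
      ((fun l : ℝ => q + l • a.2) '' Set.Ioi 0) := by
    rw [Set.disjoint_left]
    rintro _ hx ⟨l, hl, rfl⟩
    have hl : 0 < l := hl
    have : t + l ∈ s := ⟨by positivity, by
      convert interior_subset hx using 1; rw [hq]; module⟩
    linarith [htmax this]
  obtain ⟨f, c, hf0, hfK, hfray⟩ := geometric_hahn_banach_of_nonempty_interior K.convex hray hdisj
    hK ⟨_, ⟨1, by simp, rfl⟩⟩
  have hfl : ∀ l : ℝ, 0 < l → c ≤ f q + l * f a.2 := fun l hl => by
    simpa using hfray _ ⟨l, hl, rfl⟩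
  have hcq : f q = c := by
    refine le_antisymm (hfK q htK) ?_
    have hlim : Filter.Tendsto (fun l : ℝ => f q + l * f a.2) (nhdsWithin 0 (Set.Ioi 0))
        (nhds (f q + 0 * f a.2)) := by
      refine Filter.Tendsto.mono_left ?_ nhdsWithin_le_nhds
      exact Continuous.tendsto (by fun_prop) 0
    simpa using ge_of_tendsto hlim (eventually_nhdsWithin_of_forall fun l hl => hfl l hl)
  have hfu : 0 ≤ f a.2 := by linarith [hfl 1 one_pos]
  set w := (InnerProductSpace.toDual ℝ (EuclideanSpace ℝ (Fin d))).symm f with hw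
  have hfw : ∀ x, ⟪x, w⟫ = f x := fun x => by
    rw [real_inner_comm]; exact InnerProductSpace.toDual_symm_apply
  have hw0 : 0 < ‖w‖ := by
    rw [norm_pos_iff, hw]
    simpa using hf0
  have hb : (q, ‖w‖⁻¹ • w) ∈ augmentedBoundary (K : Set (EuclideanSpace ℝ (Fin d))) := by
    refine ⟨?_, ?_, fun x hx => ?_⟩
    · rw [hcl.frontier_eq]
      refine ⟨htK, fun hint => ?_⟩
      obtain ⟨δ, hδ, hball⟩ := Metric.isOpen_iff.1 isOpen_interior q hint
      have : t + δ / 2 ∈ s := by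
        refine ⟨by positivity, interior_subset (hball ?_)⟩
        have : m + (t + δ / 2) • a.2 = q + (δ / 2) • a.2 := by rw [hq]; module
        rw [this, Metric.mem_ball, dist_eq_norm, add_sub_cancel_left, norm_smul, ha.2.1,
          Real.norm_eq_abs, abs_of_pos (by positivity)]
        linarith
      linarith [htmax this]
    · simp [norm_smul, hw0.ne']
    · simp only [inner_smul_right, hfw, map_sub, hcq]
      exact mul_nonpos_of_nonneg_of_nonpos (by positivity) (by linarith [hfK x hx])
  refine ⟨q, ⟨_, ⟨mem_dualCap_of_nonneg ha hb ?_, ?_⟩, rfl⟩, t, hqa⟩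
  · simp only [inner_smul_right, hfw]
    refine mul_nonneg (by positivity) ?_
    -- Since q is at height t above the midpoint of p and r, p + 2tu is the reflection of r in q. It
    -- is thus on the far side of the hyperplane at q, and 2t ≤ ε moves p + εu no lower.
    have e : a.1 + ε • a.2 - q = (ε - 2 * t) • a.2 + (q - r) := by
      rw [hq, hm]; module
    rw [e, map_add, map_smul, map_sub, hcq, smul_eq_mul]
    have := hfK r hr
    have := mul_nonneg (sub_nonneg.2 htε) hfu
    linarith
  · rw [Metric.mem_closedBall, dist_eq_norm, hqa]
    refine (norm_add_le _ _).trans ?_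
    rw [norm_smul, norm_smul, ha.2.1, Real.norm_eq_abs, Real.norm_eq_abs, abs_of_nonneg ht0,
      abs_of_pos (by norm_num : (0 : ℝ) < 1 / 2)]
    have : ε ≤ Real.sqrt ε := Real.le_sqrt_of_sq_le (by nlinarith)
    linarith

end Membership

/-! ### Charts of hyperplanes -/

/-- Euclidean coordinates on the hyperplane orthogonal to a unit vector `u`, together with the
orthogonal projection onto it. -/
structure HyperplaneChart {d : ℕ} (n : ℕ) (u : EuclideanSpace ℝ (Fin d)) where
  /-- the inclusion of the hyperplane -/
  incl : EuclideanSpace ℝ (Fin n) →ₗᵢ[ℝ] EuclideanSpace ℝ (Fin d)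
  /-- the orthogonal projection onto the hyperplane -/
  proj : EuclideanSpace ℝ (Fin d) →ₗ[ℝ] EuclideanSpace ℝ (Fin n)
  incl_proj_add : ∀ x, incl (proj x) + ⟪x, u⟫ • u = x
  inner_incl : ∀ w, ⟪incl w, u⟫ = 0
  norm_eq_one : ‖u‖ = 1

namespace HyperplaneChart

lemma nonempty {n : ℕ} {u : EuclideanSpace ℝ (Fin (n + 1))} (hu : ‖u‖ = 1) :
    Nonempty (HyperplaneChart n u) := by
  have : Fact (Module.finrank ℝ (EuclideanSpace ℝ (Fin (n + 1))) = n + 1) := ⟨by simp⟩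
  have hu0 : u ≠ 0 := by rintro rfl; simp at hu
  let b := OrthonormalBasis.fromOrthogonalSpanSingleton (𝕜 := ℝ) n hu0
  refine ⟨⟨(ℝ ∙ u)ᗮ.subtypeₗᵢ.comp b.repr.symm.toLinearIsometry,
    b.repr.toLinearMap ∘ₗ ((ℝ ∙ u)ᗮ.orthogonalProjectionOnto).toLinearMap,
    fun x => ?_, fun w => ?_, hu⟩⟩
  · have h1 : (ℝ ∙ u).starProjection x + (ℝ ∙ u)ᗮ.starProjection x = x :=
      Submodule.starProjection_add_starProjection_orthogonal _
    rw [Submodule.starProjection_unit_singleton ℝ hu, real_inner_comm] at h1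
    rw [add_comm (_ • u)] at h1
    simpa using h1
  · exact Submodule.mem_orthogonal_singleton_iff_inner_left.1 (b.repr.symm w).2

variable {d n : ℕ} {u : EuclideanSpace ℝ (Fin d)} (c : HyperplaneChart n u)

lemma inner_self_normal {d n : ℕ} {u : EuclideanSpace ℝ (Fin d)} (c : HyperplaneChart n u) :
    ⟪u, u⟫ = 1 := by
  rw [real_inner_self_eq_norm_sq, c.norm_eq_one]; norm_num

lemma proj_incl (w : EuclideanSpace ℝ (Fin n)) : c.proj (c.incl w) = w := by
  have := c.incl_proj_add (c.incl w)
  rw [c.inner_incl, zero_smul, add_zero] at this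
  exact c.incl.injective this

lemma proj_normal : c.proj u = 0 := by
  have := c.incl_proj_add u
  rw [c.inner_self_normal, one_smul, add_eq_right] at this
  exact c.incl.injective (by rw [this, map_zero])

lemma inner_eq (x y : EuclideanSpace ℝ (Fin d)) :
    ⟪x, y⟫ = ⟪c.proj x, c.proj y⟫ + ⟪x, u⟫ * ⟪y, u⟫ := by
  conv_lhs => rw [← c.incl_proj_add x, ← c.incl_proj_add y]
  have h : ∀ w, ⟪u, c.incl w⟫ = 0 := fun w => by rw [real_inner_comm, c.inner_incl]
  simp [inner_add_left, inner_add_right, inner_smul_left, inner_smul_right, c.inner_incl, h,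
    c.norm_eq_one, mul_comm]

lemma norm_proj_le (x : EuclideanSpace ℝ (Fin d)) : ‖c.proj x‖ ≤ ‖x‖ := by
  have h := c.inner_eq x x
  rw [real_inner_self_eq_norm_sq, real_inner_self_eq_norm_sq] at h
  exact (sq_le_sq₀ (norm_nonneg _) (norm_nonneg _)).1 (by nlinarith [mul_self_nonneg ⟪x, u⟫])

lemma lipschitzWith_proj_sub (p : EuclideanSpace ℝ (Fin d)) :
    LipschitzWith 1 fun x => c.proj (x - p) := by
  refine LipschitzWith.of_dist_le_mul fun x y => ?_
  rw [dist_eq_norm, dist_eq_norm, ← map_sub, sub_sub_sub_cancel_right, NNReal.coe_one, one_mul]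
  exact c.norm_proj_le _

/-- Orthogonal projection does not increase area. -/
lemma measure_le_area {p : EuclideanSpace ℝ (Fin (n + 1))} {u : EuclideanSpace ℝ (Fin (n + 1))}
    (c : HyperplaneChart n u) {X : Set (EuclideanSpace ℝ (Fin (n + 1)))}
    {Y : Set (EuclideanSpace ℝ (Fin n))} (h : ∀ w ∈ Y, ∃ x ∈ X, c.proj (x - p) = w) :
    μH[(n : ℝ)] Y ≤ area X := by
  have h1 := (c.lipschitzWith_proj_sub p).hausdorffMeasure_image_le (Nat.cast_nonneg n) X
  rw [ENNReal.coe_one, ENNReal.one_rpow, one_mul] at h1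
  have h2 : Y ⊆ (fun x => c.proj (x - p)) '' X := fun w hw => h w hw
  have h3 : area X = μH[(n : ℝ)] X := by simp [area]
  rw [h3]
  exact (measure_mono h2).trans h1

end HyperplaneChart

/-! ### The simplex attached to a restricted dual cap -/

section Simplex

variable {d n : ℕ} {K : ConvexBody (EuclideanSpace ℝ (Fin d))} {ε : ℝ}
  {a : EuclideanSpace ℝ (Fin d) × EuclideanSpace ℝ (Fin d)}

/-- Up to the factor `2`, the point `x` scaled towards `p` by `ε / capScale ε a x` is close to `p`
and to the supporting hyperplane. -/
noncomputable def capScale (ε : ℝ) (a : EuclideanSpace ℝ (Fin d) × EuclideanSpace ℝ (Fin d))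
    (x : EuclideanSpace ℝ (Fin d)) : ℝ :=
  ε + ‖x - a.1‖ ^ 2 - 2 * ⟪x - a.1, a.2⟫

/-- The height of x over the supporting hyperplane is nonpositive. The bound makes the scale
positive and controls distances, since √ε ‖x - p‖ ≤ ε + ‖x - p‖². -/
lemma le_capScale (ha : a ∈ augmentedBoundary (K : Set (EuclideanSpace ℝ (Fin d))))
    {x : EuclideanSpace ℝ (Fin d)} (hx : x ∈ K) : ε + ‖x - a.1‖ ^ 2 ≤ capScale ε a x := by
  unfold capScale
  linarith [ha.2.2 x hx]

/-- A basis of scaled projections of points of `K` whose polar parallelotope is controlled by all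
of `K`. -/
lemma exists_basis_capScale (hn : 0 < n)
    (hK : (interior (K : Set (EuclideanSpace ℝ (Fin d)))).Nonempty)
    (ha : a ∈ augmentedBoundary (K : Set (EuclideanSpace ℝ (Fin d)))) (hε : 0 < ε)
    (c : HyperplaneChart n a.2) :
    ∃ g : Fin n → EuclideanSpace ℝ (Fin n), LinearIndependent ℝ g ∧
      (∀ i, ∃ x ∈ K, g i = (2 / capScale ε a x) • c.proj (x - a.1)) ∧
      ∀ z ∈ polarParallelotope g, ∀ x ∈ K, 2 * |⟪c.proj (x - a.1), z⟫| ≤ capScale ε a x := by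
  set φ : EuclideanSpace ℝ (Fin d) → EuclideanSpace ℝ (Fin n) := fun x =>
    (2 / capScale ε a x) • c.proj (x - a.1) with hφ
  have hpos : ∀ x ∈ K, 0 < capScale ε a x := fun x hx =>
    (by positivity : 0 < ε + ‖x - a.1‖ ^ 2).trans_le (le_capScale ha hx)
  have hφc : ContinuousOn φ K := by
    have h1 : Continuous fun x => c.proj (x - a.1) := (c.lipschitzWith_proj_sub a.1).continuous
    refine ContinuousOn.smul (continuousOn_const.div ?_ fun x hx => (hpos x hx).ne')
      h1.continuousOn
    unfold capScale
    fun_prop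
  -- A vector orthogonal to all scaled projections is orthogonal to every P(x - p); moving an
  -- interior point along it shows that it is zero.
  have hspan : Submodule.span ℝ (φ '' (K : Set (EuclideanSpace ℝ (Fin d)))) = ⊤ := by
    rw [← Submodule.orthogonal_eq_bot_iff, Submodule.eq_bot_iff]
    intro z hz
    have hz' : ∀ x ∈ K, ⟪c.proj (x - a.1), z⟫ = 0 := fun x hx => by
      have h := (Submodule.mem_orthogonal _ z).1 hz (φ x) (Submodule.subset_span ⟨x, hx, rfl⟩)
      rw [hφ, inner_smul_left] at h
      simpa [(hpos x hx).ne'] using h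
    obtain ⟨x, hx⟩ := hK
    have hcont : Filter.Tendsto (fun t : ℝ => x + t • c.incl z) (nhds 0) (nhds x) := by
      have : Continuous fun t : ℝ => x + t • c.incl z := by fun_prop
      simpa using this.tendsto 0
    have hev : ∀ᶠ t in nhdsWithin (0 : ℝ) (Set.Ioi 0), x + t • c.incl z ∈
        interior (K : Set (EuclideanSpace ℝ (Fin d))) :=
      (hcont.mono_left nhdsWithin_le_nhds).eventually (isOpen_interior.mem_nhds hx)
    obtain ⟨t, htK, ht⟩ := (hev.and self_mem_nhdsWithin).exists
    have ht : 0 < t := ht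
    have h1 := hz' _ (interior_subset hx)
    have h2 := hz' _ (interior_subset htK)
    rw [add_sub_right_comm, map_add, map_smul, c.proj_incl, inner_add_left, h1,
      inner_smul_left] at h2
    simpa [ht.ne'] using h2
  obtain ⟨g, hgG, hgi, hg⟩ :=
    exists_linearIndependent_coord_le_one (K.isCompact.image_of_continuousOn hφc) hspan
  refine ⟨g, hgi, fun i => ?_, fun z hz x hx => ?_⟩
  · obtain ⟨x, hx, hxg⟩ := hgG i
    exact ⟨x, hx, hxg.symm⟩
  · obtain ⟨t, ht, hxt⟩ := hg (φ x) ⟨x, hx, rfl⟩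
    have h1 : |⟪φ x, z⟫| ≤ 1 := by
      have hn' : (0 : ℝ) < n := by exact_mod_cast hn
      refine le_of_mul_le_mul_left ?_ hn'
      -- The factor n in `polarParallelotope` pays for the n terms of the sum.
      calc (n : ℝ) * |⟪φ x, z⟫| ≤ n * ∑ i, |t i| * |⟪g i, z⟫| := by
            rw [hxt, sum_inner]
            gcongr
            refine (Finset.abs_sum_le_sum_abs _ _).trans_eq ?_
            simp [inner_smul_left, abs_mul]
        _ ≤ n * ∑ i, |⟪g i, z⟫| := by
            gcongr with i
            exact mul_le_of_le_one_left (abs_nonneg _) (ht i)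
        _ = ∑ i, n * |⟪g i, z⟫| := Finset.mul_sum _ _ _
        _ ≤ ∑ _i : Fin n, 1 := Finset.sum_le_sum fun i _ => hz i
        _ = n * 1 := by simp
    have hm := hpos x hx
    rw [hφ, inner_smul_left, abs_mul, conj_trivial, abs_of_pos (by positivity), div_mul_eq_mul_div,
      div_le_one hm] at h1
    exact h1

/-- The projection of the patch of the restricted dual cap contains a copy of the corner simplex
scaled by `ε / 4`. -/
lemma exists_mem_patch_of_mem_cornerSimplex
    (hK : (interior (K : Set (EuclideanSpace ℝ (Fin d)))).Nonempty)
    (ha : a ∈ augmentedBoundary (K : Set (EuclideanSpace ℝ (Fin d)))) (hε : 0 < ε) (hε1 : ε ≤ 1)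
    (c : HyperplaneChart n a.2) {g : Fin n → EuclideanSpace ℝ (Fin n)}
    (hg : ∀ i, ∃ x ∈ K, g i = (2 / capScale ε a x) • c.proj (x - a.1))
    {w : EuclideanSpace ℝ (Fin n)} (hw : w ∈ cornerSimplex g) :
    ∃ q ∈ patch (restrictedDualCap K ε (Real.sqrt ε) a), c.proj (q - a.1) = (ε / 4) • w := by
  have hp : a.1 ∈ (K : Set (EuclideanSpace ℝ (Fin d))) :=
    K.isCompact.isClosed.frontier_subset ha.1
  choose x hxK hx using hg
  obtain ⟨t, ht0, ht1, rfl⟩ := hw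
  set C : Set (EuclideanSpace ℝ (Fin d)) :=
    (K ∩ Metric.closedBall a.1 (Real.sqrt ε)) ∩ {y | -ε + ⟪a.1, a.2⟫ ≤ ⟪y, a.2⟫} with hC
  have hCc : Convex ℝ C := by
    refine (K.convex.inter (convex_closedBall _ _)).inter (convex_halfSpace_ge ?_ _)
    exact ⟨fun x y => inner_add_left x y _, fun r x => by simp [inner_smul_left]⟩
  have hpC : a.1 ∈ C := ⟨⟨hp, by simp⟩, by simp [hε.le]⟩
  -- These points project to (ε / 2) `g i`; passing to midpoints below turns ε / 2 into ε / 4.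
  set y : Fin n → EuclideanSpace ℝ (Fin d) := fun i =>
    a.1 + (ε / capScale ε a (x i)) • (x i - a.1) with hy
  have hyC : ∀ i, y i ∈ C := fun i => by
    have hle := le_capScale (ε := ε) ha (hxK i)
    have hN := norm_nonneg (x i - a.1)
    have hm : 0 < capScale ε a (x i) := by nlinarith
    have hu := ha.2.2 _ (hxK i)
    have hs0 : 0 ≤ ε / capScale ε a (x i) := by positivity
    have hs1 : ε / capScale ε a (x i) ≤ 1 := by rw [div_le_one hm]; nlinarith
    refine ⟨⟨?_, ?_⟩, ?_⟩
    · exact K.convex.add_smul_sub_mem hp (hxK i) ⟨hs0, hs1⟩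
    · rw [Metric.mem_closedBall, dist_eq_norm, add_sub_cancel_left, norm_smul, Real.norm_eq_abs,
        abs_of_nonneg hs0, div_mul_eq_mul_div, div_le_iff₀ hm]
      have hsq := Real.sq_sqrt hε.le
      have hs := Real.sqrt_pos.2 hε
      have h2 : Real.sqrt ε * ‖x i - a.1‖ ≤ ε + ‖x i - a.1‖ ^ 2 := by
        nlinarith [sq_nonneg (Real.sqrt ε - ‖x i - a.1‖)]
      calc ε * ‖x i - a.1‖ = Real.sqrt ε * (Real.sqrt ε * ‖x i - a.1‖) := by
            rw [← mul_assoc, ← sq, hsq]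
        _ ≤ Real.sqrt ε * capScale ε a (x i) := by gcongr; linarith
    · have : -1 * ε ≤ ε / capScale ε a (x i) * ⟪x i - a.1, a.2⟫ := by
        rw [div_mul_eq_mul_div, le_div_iff₀ hm]
        unfold capScale at hm ⊢
        nlinarith [sq_nonneg ‖x i - a.1‖]
      simp only [Set.mem_ofPred_eq, hy, inner_add_left, inner_smul_left, conj_trivial]
      linarith
  -- The missing weight goes to p, which corresponds to the vertex 0 of the simplex.
  set r : EuclideanSpace ℝ (Fin d) := (1 - ∑ i, t i) • a.1 + ∑ i, t i • y i with hr
  have hrC : r ∈ C := by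
    have := hCc.sum_mem (t := Finset.univ) (w := fun o : Option (Fin n) =>
      o.elim (1 - ∑ i, t i) t) (z := fun o => o.elim a.1 y)
      (by rintro (_ | i) -; exacts [by simpa using ht1, ht0 i])
      (by simp [Fintype.sum_option])
      (by rintro (_ | i) -; exacts [hpC, hyC i])
    simpa [Fintype.sum_option] using this
  have hra : r - a.1 = ∑ i, t i • ((ε / capScale ε a (x i)) • (x i - a.1)) := by
    simp only [hr, hy, smul_add, Finset.sum_add_distrib, ← Finset.sum_smul, sub_smul, one_smul]
    abel
  obtain ⟨q, hq, s, hqs⟩ := exists_mem_patch_above_midpoint hK ha hε hε1 hrC.1.1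
    (by rw [inner_sub_left]; linarith [show -ε + ⟪a.1, a.2⟫ ≤ ⟪r, a.2⟫ from hrC.2])
    (by simpa [dist_eq_norm] using hrC.1.2)
  refine ⟨q, hq, ?_⟩
  rw [hqs, map_add, map_smul, map_smul, c.proj_normal, smul_zero, add_zero, hra, map_sum,
    Finset.smul_sum, Finset.smul_sum]
  refine Finset.sum_congr rfl fun i _ => ?_
  rw [map_smul, map_smul, hx, smul_smul, smul_smul, smul_smul, smul_smul]
  congr 1
  ring

/-- Points above the polar parallelotope are in the Voronoi region of the restricted dual cap. -/
lemma mem_vor_of_mem_polarParallelotope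
    (ha : a ∈ augmentedBoundary (K : Set (EuclideanSpace ℝ (Fin d)))) (hε : 0 < ε)
    (c : HyperplaneChart n a.2) {z : EuclideanSpace ℝ (Fin n)}
    (hz : ∀ x ∈ K, 2 * |⟪c.proj (x - a.1), z⟫| ≤ capScale ε a x) {y : ℝ} (hy : 1 ≤ y) :
    a.1 + (c.incl z + y • a.2) ∈ vor K (restrictedDualCap K ε (Real.sqrt ε) a) := by
  have hyu : ⟪c.incl z + y • a.2, a.2⟫ = y := by
    rw [inner_add_left, c.inner_incl, inner_smul_left, c.inner_self_normal]; simp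
  refine mem_vor_restrictedDualCap ha hε.le (by rwa [add_sub_cancel_left, hyu]) fun x hx => ?_
  rw [add_sub_cancel_left, c.inner_eq, hyu, map_add, map_smul, c.proj_incl, c.proj_normal,
    smul_zero, add_zero, real_inner_comm]
  -- With h ≤ 0 the height of x, the term 2yh absorbs the -2h in the scale exactly when y ≥ 1.
  have h1 := hz x hx
  have h2 := le_abs_self ⟪c.proj (x - a.1), z⟫
  have h3 := ha.2.2 x hx
  unfold capScale at h1
  nlinarith

/-- For a fat body the polar parallelotope is bounded in terms of the fatness. -/
lemma mul_norm_le_of_isFat {γ : ℝ}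
    (ha : a ∈ augmentedBoundary (K : Set (EuclideanSpace ℝ (Fin d)))) (hε : 0 < ε)
    (hε1 : ε ≤ 1 / 8) (hfat : IsFat γ (K : Set (EuclideanSpace ℝ (Fin d))))
    (hdiam : 2 * ε ≤ Metric.diam (K : Set (EuclideanSpace ℝ (Fin d))))
    (c : HyperplaneChart n a.2) {z : EuclideanSpace ℝ (Fin n)}
    (hz : ∀ x ∈ K, 2 * |⟪c.proj (x - a.1), z⟫| ≤ capScale ε a x) :
    γ * ‖z‖ ≤ 3 := by
  have hp : a.1 ∈ (K : Set (EuclideanSpace ℝ (Fin d))) :=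
    K.isCompact.isClosed.frontier_subset ha.1
  obtain ⟨o, r, R, hr, hR, hγ, hin, hout⟩ := hfat
  rcases eq_or_ne z 0 with rfl | hz0
  · simp
  have hznorm : 0 < ‖z‖ := norm_pos_iff.2 hz0
  have hεR : ε ≤ R := by
    have := (Metric.diam_mono hout Metric.isBounded_closedBall).trans
      (Metric.diam_closedBall hR.le)
    linarith
  have hs1 : ε / R ≤ 1 := (div_le_one hR).2 hεR
  have hs0 : 0 < ε / R := by positivity
  -- the scaled points in the two directions `± z`
  have key : ∀ σ : ℝ, |σ| = 1 → 2 * |⟪c.proj ((ε / R) • (o - a.1 + (σ * r / ‖z‖) • c.incl z)), z⟫|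
      ≤ 6 * ε := fun σ hσ => by
    set x₀ := o + (σ * r / ‖z‖) • c.incl z with hx₀
    have hx₀K : x₀ ∈ (K : Set (EuclideanSpace ℝ (Fin d))) := by
      refine hin ?_
      rw [Metric.mem_closedBall, dist_eq_norm, hx₀, add_sub_cancel_left, norm_smul,
        c.incl.norm_map, Real.norm_eq_abs, abs_div, abs_mul, hσ, abs_of_pos hr,
        abs_of_pos hznorm, div_mul_cancel₀ _ hznorm.ne', one_mul]
    have hnorm : ‖x₀ - a.1‖ ≤ 2 * R := by
      have h1 := Metric.mem_closedBall.1 (hout hx₀K)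
      have h2 := Metric.mem_closedBall'.1 (hout hp)
      rw [← dist_eq_norm]
      linarith [dist_triangle x₀ o a.1]
    have hxK : a.1 + (ε / R) • (x₀ - a.1) ∈ (K : Set (EuclideanSpace ℝ (Fin d))) :=
      K.convex.add_smul_sub_mem hp hx₀K ⟨hs0.le, hs1⟩
    have hb := hz _ hxK
    have he : x₀ - a.1 = o - a.1 + (σ * r / ‖z‖) • c.incl z := by rw [hx₀]; abel
    rw [add_sub_cancel_left, he] at hb
    refine hb.trans ?_
    unfold capScale
    rw [add_sub_cancel_left, ← he]
    -- The scale is then at most ε + 4ε² + 4ε, which is below 6ε as ε ≤ 1/8.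
    have hv : ‖(ε / R) • (x₀ - a.1)‖ ≤ 2 * ε := by
      rw [norm_smul, Real.norm_eq_abs, abs_of_pos hs0, div_mul_eq_mul_div, div_le_iff₀ hR]
      nlinarith
    have hi := (abs_le.1 (abs_real_inner_le_norm ((ε / R) • (x₀ - a.1)) a.2)).1
    rw [ha.2.1, mul_one] at hi
    have hv0 := norm_nonneg ((ε / R) • (x₀ - a.1))
    nlinarith
  have h1 := key 1 (by simp)
  have h2 := key (-1) (by simp)
  simp only [map_smul, map_add, c.proj_incl, inner_smul_left, inner_add_left, conj_trivial,
    real_inner_self_eq_norm_sq] at h1 h2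
  -- The unknown contribution `A` of the ball's center cancels between the two directions.
  set A := ⟪c.proj (o - a.1), z⟫
  have e1 : 1 * r / ‖z‖ * ‖z‖ ^ 2 = r * ‖z‖ := by field_simp
  have e2 : -1 * r / ‖z‖ * ‖z‖ ^ 2 = -(r * ‖z‖) := by field_simp
  rw [e1] at h1
  rw [e2] at h2
  have h3 := le_abs_self (ε / R * (A + r * ‖z‖))
  have h4 := neg_abs_le (ε / R * (A + -(r * ‖z‖)))
  have h5 : r / R * ‖z‖ * ε ≤ 3 * ε := by
    have : r / R * ‖z‖ * ε = ε / R * (r * ‖z‖) := by ring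
    rw [this]
    linarith
  have h6 := le_of_mul_le_mul_right h5 hε
  exact (mul_le_mul_of_nonneg_right hγ hznorm.le).trans h6

end Simplex

/-! ### The area-product bound -/

/-- The point at which a line in direction `u` starting in the ball of radius two leaves the sphere
of radius three. -/
lemma exists_one_le_add_smul_mem_sphere {E : Type*} [NormedAddCommGroup E] [NormedSpace ℝ E]
    {v u : E} (hv : ‖v‖ ≤ 2) (hu : ‖u‖ = 1) :
    ∃ t : ℝ, 1 ≤ t ∧ v + t • u ∈ Metric.sphere (0 : E) 3 := by
  have hcont : ContinuousOn (fun t : ℝ => ‖v + t • u‖) (Set.Icc 1 5) := by fun_prop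
  have h1 : ‖v + (1 : ℝ) • u‖ ≤ 3 := by
    refine (norm_add_le _ _).trans ?_
    rw [one_smul, hu]
    linarith
  have h5 : 3 ≤ ‖v + (5 : ℝ) • u‖ := by
    have := norm_sub_norm_le ((5 : ℝ) • u) (-v)
    rw [norm_smul, hu, norm_neg, sub_neg_eq_add, add_comm] at this
    norm_num at this
    linarith
  obtain ⟨t, ht, ht3⟩ := intermediate_value_Icc (by norm_num) hcont ⟨h1, h5⟩
  exact ⟨t, ht.1, by simpa using ht3⟩

open scoped Pointwise in
/-- A lower bound on the product of the areas of two sets, the projections of which contain scaled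
copies of a corner simplex and of its polar parallelotope. -/
lemma ofReal_lt_area_mul_area {n : ℕ} {C s t : ℝ} (hs : 0 < s) (ht : 0 < t)
    {g : Fin n → EuclideanSpace ℝ (Fin n)}
    (hC : ENNReal.ofReal C < μH[(n : ℝ)] (cornerSimplex g) * μH[(n : ℝ)] (polarParallelotope g))
    {p u : EuclideanSpace ℝ (Fin (n + 1))} (c : HyperplaneChart n u)
    {X Y : Set (EuclideanSpace ℝ (Fin (n + 1)))}
    (hX : ∀ w ∈ cornerSimplex g, ∃ x ∈ X, c.proj (x - p) = s • w)
    (hY : ∀ z ∈ polarParallelotope g, ∃ y ∈ Y, c.proj (y - p) = t • z) :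
    ENNReal.ofReal (s ^ n * t ^ n * C) < area X * area Y := by
  have hH : (μH[(n : ℝ)] : Measure (EuclideanSpace ℝ (Fin n))).IsAddHaarMeasure := by
    simpa using isAddHaarMeasure_hausdorffMeasure (E := EuclideanSpace ℝ (Fin n))
  have h1 := c.measure_le_area (Y := s • cornerSimplex g) (p := p) (X := X) (by
    rintro _ ⟨w, hw, rfl⟩
    exact hX w hw)
  have h2 := c.measure_le_area (Y := t • polarParallelotope g) (p := p) (X := Y) (by
    rintro _ ⟨w, hw, rfl⟩
    exact hY w hw)
  rw [Measure.addHaar_smul, finrank_euclideanSpace_fin, abs_of_pos (by positivity)] at h1 h2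
  refine lt_of_lt_of_le ?_ (mul_le_mul' h1 h2)
  rw [mul_mul_mul_comm, ← ENNReal.ofReal_mul (by positivity), ENNReal.ofReal_mul (by positivity)]
  exact ENNReal.mul_lt_mul_right (by simp; positivity) ENNReal.ofReal_ne_top hC

theorem mainTheorem2 (d : ℕ) (hd : 2 ≤ d) :
    (∃ c' : ℝ, 0 < c' ∧
      ∀ (K : ConvexBody (EuclideanSpace ℝ (Fin d))) (ε : ℝ)
        (a : EuclideanSpace ℝ (Fin d) × EuclideanSpace ℝ (Fin d)) (y : ℝ),
        (interior (K : Set (EuclideanSpace ℝ (Fin d)))).Nonempty →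
        0 < ε → ε ≤ 1 / 8 →
        a ∈ augmentedBoundary (K : Set (EuclideanSpace ℝ (Fin d))) →
        1 ≤ y →
        ENNReal.ofReal (c' * ε ^ (d - 1)) ≤
          area (patch (restrictedDualCap K ε (Real.sqrt ε) a)) *
            area (vor K (restrictedDualCap K ε (Real.sqrt ε) a) ∩ parallelHyperplane a y)) ∧
    (∃ c : ℝ, 0 < c ∧
      ∀ (γ : ℝ) (K : ConvexBody (EuclideanSpace ℝ (Fin d))) (ε : ℝ)
        (a : EuclideanSpace ℝ (Fin d) × EuclideanSpace ℝ (Fin d)),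
        (interior (K : Set (EuclideanSpace ℝ (Fin d)))).Nonempty →
        0 < γ → γ ≤ 1 →
        IsFat γ (K : Set (EuclideanSpace ℝ (Fin d))) →
        0 < ε → ε ≤ 1 / 8 →
        2 * ε ≤ Metric.diam (K : Set (EuclideanSpace ℝ (Fin d))) →
        a ∈ augmentedBoundary (K : Set (EuclideanSpace ℝ (Fin d))) →
        ‖a.1‖ ≤ 1 →
        ENNReal.ofReal (c * γ ^ (d - 1) * ε ^ (d - 1)) <
          area (patch (restrictedDualCap K ε (Real.sqrt ε) a)) *
            area (vor K (restrictedDualCap K ε (Real.sqrt ε) a) ∩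
              Metric.sphere (0 : EuclideanSpace ℝ (Fin d)) 3)) := by
  obtain ⟨n, rfl⟩ : ∃ n, d = n + 1 := ⟨d - 1, by omega⟩
  have hn : 0 < n := by omega
  have hH : (μH[(n : ℝ)] : Measure (EuclideanSpace ℝ (Fin n))).IsAddHaarMeasure := by
    simpa using isAddHaarMeasure_hausdorffMeasure (E := EuclideanSpace ℝ (Fin n))
  obtain ⟨C, hC0, hC⟩ :=
    exists_pos_lt_measure_cornerSimplex_mul_polarParallelotope n μH[(n : ℝ)]
  rw [Nat.add_sub_cancel]
  refine ⟨⟨C / 4 ^ n, by positivity, fun K ε a y hK hε hε8 ha hy => ?_⟩,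
    ⟨C / 12 ^ n, by positivity, fun γ K ε a hK hγ hγ1 hfat hε hε8 hdiam ha hp => ?_⟩⟩
  all_goals
    obtain ⟨c⟩ := HyperplaneChart.nonempty ha.2.1
    obtain ⟨g, hgi, hgK, hgz⟩ := exists_basis_capScale hn hK ha hε c
    have hpatch := fun w hw => exists_mem_patch_of_mem_cornerSimplex hK ha hε
      (hε8.trans (by norm_num)) c hgK (w := w) hw
  · refine le_of_eq_of_le ?_ (ofReal_lt_area_mul_area (s := ε / 4) (t := 1) (by positivity)
      one_pos (hC g hgi) c hpatch fun z hz => ?_).le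
    · rw [div_pow]; congr 1; ring
    · refine ⟨_, ⟨mem_vor_of_mem_polarParallelotope ha hε c (hgz z hz) hy, ?_⟩, ?_⟩
      · change ⟪a.1 + (c.incl z + y • a.2) - a.1, a.2⟫ = y
        rw [add_sub_cancel_left, inner_add_left, c.inner_incl, inner_smul_left,
          c.inner_self_normal]
        simp
      · simp [c.proj_incl, c.proj_normal]
  · refine lt_of_eq_of_lt ?_ (ofReal_lt_area_mul_area (s := ε / 4) (t := γ / 3) (by positivity)
      (by positivity) (hC g hgi) c hpatch fun z hz => ?_)
    · rw [div_pow, div_pow, show (12 : ℝ) = 4 * 3 by norm_num, mul_pow]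
      congr 1
      field_simp
    · have hznorm := mul_norm_le_of_isFat ha hε hε8 hfat hdiam c (hgz z hz)
      have hle : ‖a.1 + c.incl ((γ / 3) • z)‖ ≤ 2 := by
        refine (norm_add_le _ _).trans ?_
        rw [c.incl.norm_map, norm_smul, Real.norm_eq_abs, abs_of_pos (by positivity)]
        linarith
      obtain ⟨t, ht, hts⟩ := exists_one_le_add_smul_mem_sphere hle ha.2.1
      rw [add_assoc] at hts
      refine ⟨_, ⟨mem_vor_of_mem_polarParallelotope ha hε c (fun x hx => ?_) ht, hts⟩, ?_⟩
      -- The scale inequality survives shrinking z, as γ / 3 ≤ 1.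
      · refine le_trans ?_ (hgz z hz x hx)
        rw [inner_smul_right, abs_mul, abs_of_pos (by positivity)]
        nlinarith [abs_nonneg ⟪c.proj (x - a.1), z⟫]
      · simp [c.proj_incl, c.proj_normal]
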